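/- Let $p$ be a prime and let $G$ be a finite $p$-group of order $n\ge 2$. Let $\mathcal{G}(G)$ be the power graph of $G$, that is, the simple graph with vertex set $G$ in which two distinct elements are adjacent if and only if one of them is a positive power of the other. Let $\kappa(\mathcal{G}(G))$ be its vertex connectivity, that is, the minimum number of vertices whose removal leaves a disconnected graph or a graph with just one vertex. Let $\lambda_1\ge\lambda_2\ge\dots\ge\lambda_n=0$ be the eigenvalues, with multiplicity, of the Laplacian matrix (degree matrix minus adjacency matrix) of $\mathcal{G}(G)$; $\lambda_{n-1}(\mathcal{G}(G))$ is its algebraic connectivity. Then $$\kappa(\mathcal{G}(G))=\lambda_{n-1}(\mathcal{G}(G))\quad\text{if and only if}\quad G\text{ is not cyclic}.$$ Moreover, if $G$ is a generalized quaternion group, i.e. $G\cong\langle a,b\mid a^{2m}=1,\ a^m=b^2,\ ab=ba^{-1}\rangle$ with $m=2^k$, $k\ge 1$, then $\kappa(\mathcal{G}(G))=\lambda_{n-1}(\mathcal{G}(G))=2$; and if $G$ is neither cyclic nor generalized quaternion, then $\kappa(\mathcal{G}(G))=\lambda_{n-1}(\mathcal{G}(G))=1$. -/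

import Mathlib

/-- The power graph of a group `G`: the vertices are the elements of `G`, and two distinct
elements are adjacent if one of them is a positive power of the other. -/
def powerGraph (G : Type*) [Group G] : SimpleGraph G where
  Adj u v := u ≠ v ∧ ((∃ k : ℕ, 0 < k ∧ v = u ^ k) ∨ (∃ k : ℕ, 0 < k ∧ u = v ^ k))
  symm := ⟨fun _ _ h => ⟨h.1.symm, h.2.symm⟩⟩
  loopless := ⟨fun _ h => h.1 rfl⟩

/-- The vertex connectivity of a finite graph: the minimum number of vertices whose removal makes
the graph disconnected or leaves exactly one vertex. It is `0` for disconnected graphs and for the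
graph with one vertex (remove nothing). Disconnected is expressed by `¬ Preconnected`, so that
removing all the vertices does not count. -/
noncomputable def vertexConnectivity {V : Type*} [Fintype V] (Γ : SimpleGraph V) : ℕ :=
  sInf {k : ℕ | ∃ S : Finset V, S.card = k ∧
    (¬ (Γ.induce ((S : Set V)ᶜ)).Preconnected ∨ ((S : Set V)ᶜ).ncard = 1)}

open Classical in
/-- The algebraic connectivity `λ_{n-1}` of a graph on `n ≥ 2` vertices: the second smallest
eigenvalue, with multiplicity, of the Laplacian matrix. Here `Matrix.IsHermitian.eigenvalues₀` lists
the eigenvalues in non-increasing order with indices `0, …, n - 1`, so that `λ_{n-1}` has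
index `n - 2`. -/
noncomputable def algebraicConnectivity {V : Type*} [Fintype V] [Nontrivial V]
    (Γ : SimpleGraph V) : ℝ :=
  (Γ.isHermitian_lapMatrix ℝ).eigenvalues₀
    ⟨Fintype.card V - 2, Nat.sub_lt Fintype.card_pos two_pos⟩

/-- A generalized quaternion group: a dicyclic group `⟨a, b ∣ a^(2n) = 1, a^n = b^2, ab = ba⁻¹⟩`
of order `4n`, where `n ≥ 2` is a power of `2`. -/
def IsGeneralizedQuaternion (G : Type*) [Group G] : Prop :=
  ∃ k : ℕ, 1 ≤ k ∧ Nonempty (G ≃* QuaternionGroup (2 ^ k))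

/-! Suppose every vertex of a set `D` is joined to all other vertices, and deleting `D` leaves a
nonempty set `C` with no edges to the nonempty rest `E`. Then vertex connectivity and algebraic
connectivity both equal `|D|`. A smaller cut misses some `d` in `D`, and `d` keeps the graph
connected. A Laplacian eigenvector with eigenvalue below `|D|` is constant by a maximum principle,
while the vector equal to `|E|` on `C`, `-|C|` on `E` and `0` on `D` has eigenvalue `|D|`.

For a cyclic `p`-group the power graph is complete, so the algebraic connectivity is at least `n`
and the vertex connectivity is below `n`. With two subgroups of order `p`, take `D = {1}` and let
`C` be the elements having one of these subgroups among their powers. Otherwise a noncyclic `G` is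
generalized quaternion, and `D = {1, z}` is its center, `C` the rest of the cyclic subgroup
generated by `a 1`.

That classification rests on a self-centralizing normal abelian subgroup, which is cyclic, say
generated by `a`. If `x` lies just outside it and does not invert `a`, a congruence modulo `p ^ m`
yields some `x * a ^ i` of order `p`, a second subgroup of order `p`. -/

/-! ### Eigenvectors and the second smallest Laplacian eigenvalue -/

open Matrix in
/-- Two eigenvectors of a Hermitian matrix for different eigenvalues are orthogonal. -/
theorem Matrix.IsHermitian.dotProduct_eq_zero_of_mulVec_eq_smul {n : Type*} [Fintype n]
    {A : Matrix n n ℝ} (hA : A.IsHermitian) {x y : n → ℝ} {a b : ℝ} (hx : A *ᵥ x = a • x)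
    (hy : A *ᵥ y = b • y) (hab : a ≠ b) : x ⬝ᵥ y = 0 := by
  have hT : Aᵀ = A := by simpa using hA.eq
  have h : a * (x ⬝ᵥ y) = b * (x ⬝ᵥ y) := by
    rw [← smul_eq_mul, ← smul_dotProduct, ← hx, ← smul_eq_mul, ← dotProduct_smul, ← hy,
      dotProduct_mulVec, ← mulVec_transpose, hT]
  by_contra h0
  exact hab (mul_right_cancel₀ h0 h)

open Matrix in
/-- The eigenvectors of a Hermitian matrix that belong to the sorted eigenvalues. -/
theorem Matrix.IsHermitian.exists_orthonormalBasis_eigenvalues₀ {n : Type*} [Fintype n]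
    [DecidableEq n] {A : Matrix n n ℝ} (hA : A.IsHermitian) :
    ∃ b : OrthonormalBasis (Fin (Fintype.card n)) ℝ (EuclideanSpace ℝ n),
      ∀ i, A *ᵥ (b i : n → ℝ) = hA.eigenvalues₀ i • (b i : n → ℝ) := by
  refine ⟨hA.eigenvectorBasis.reindex (Fintype.equivOfCardEq (Fintype.card_fin _)).symm,
    fun i => ?_⟩
  have h := hA.mulVec_eigenvectorBasis (Fintype.equivOfCardEq (Fintype.card_fin _) i)
  rw [Matrix.IsHermitian.eigenvalues, Equiv.symm_apply_apply] at h
  simpa [OrthonormalBasis.reindex_apply] using h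

open Classical in
/-- If every eigenvector of the Laplacian for an eigenvalue below `c` is constant, then the
algebraic connectivity is at least `c`. -/
theorem le_algebraicConnectivity {V : Type*} [Fintype V] [Nontrivial V] {Γ : SimpleGraph V} {c : ℝ}
    (h : ∀ (μ : ℝ) (x : V → ℝ), μ < c → (Γ.lapMatrix ℝ).mulVec x = μ • x → ∀ u v, x u = x v) :
    c ≤ algebraicConnectivity Γ := by
  by_contra! hlt
  obtain ⟨b, hb⟩ := (Γ.isHermitian_lapMatrix ℝ).exists_orthonormalBasis_eigenvalues₀
  have hcard : 1 < Fintype.card V := Fintype.one_lt_card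
  set i : Fin (Fintype.card V) := ⟨Fintype.card V - 2, Nat.sub_lt Fintype.card_pos two_pos⟩
  set j : Fin (Fintype.card V) := ⟨Fintype.card V - 1, Nat.sub_lt Fintype.card_pos one_pos⟩
  have hij : i < j := by simp only [i, j, Fin.mk_lt_mk]; omega
  -- The last two eigenvalues both lie below `c`, so two orthogonal eigenvectors would be nonzero
  -- constants.
  have hi := h _ _ hlt (hb i)
  have hj := h _ _ (((Γ.isHermitian_lapMatrix ℝ).eigenvalues₀_antitone hij.le).trans_lt hlt) (hb j)
  obtain ⟨u⟩ : Nonempty V := inferInstance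
  have hne : ∀ k, (∀ v w, b k v = b k w) → b k u ≠ 0 := by
    intro k hk h0
    refine b.toBasis.ne_zero k ?_
    ext v
    simp [hk v u, h0]
  have h0 : inner ℝ (b i) (b j) = 0 := b.orthonormal.2 hij.ne
  rw [PiLp.inner_apply, Finset.sum_congr rfl (fun v _ => by rw [hi v u, hj v u])] at h0
  simp [hne i hi, hne j hj] at h0

open Classical in
/-- A nonconstant eigenvector of the Laplacian bounds the algebraic connectivity from above. -/
theorem algebraicConnectivity_le {V : Type*} [Fintype V] [Nontrivial V] {Γ : SimpleGraph V} {c : ℝ}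
    (hc : 0 ≤ c) {x : V → ℝ} (hx : (Γ.lapMatrix ℝ).mulVec x = c • x)
    (hne : ∃ u v, x u ≠ x v) : algebraicConnectivity Γ ≤ c := by
  by_contra! hlt
  have hL := Γ.isHermitian_lapMatrix ℝ
  obtain ⟨b, hb⟩ := hL.exists_orthonormalBasis_eigenvalues₀
  set j : Fin (Fintype.card V) := ⟨Fintype.card V - 1, Nat.sub_lt Fintype.card_pos one_pos⟩
  -- All eigenvalues but the last exceed `c`, so eigenvectors for values at most `c` are multiples
  -- of `b j`; this applies to `x` and to the constant vector.
  have key : ∀ (d : ℝ) (y : V → ℝ), d ≤ c → (Γ.lapMatrix ℝ).mulVec y = d • y →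
      ∃ t : ℝ, ∀ v, y v = t * b j v := by
    intro d y hd hy
    have h0 : ∀ i, i ≠ j → inner ℝ (b i) (WithLp.toLp 2 y) = 0 := by
      intro i hi
      have hlt' : c < hL.eigenvalues₀ i := by
        refine hlt.trans_le (hL.eigenvalues₀_antitone ?_)
        have := i.2
        have : (i : ℕ) ≠ Fintype.card V - 1 := fun h => hi (Fin.ext h)
        rw [Fin.le_def]
        simp only
        omega
      have := hL.dotProduct_eq_zero_of_mulVec_eq_smul hy (hb i) (hd.trans_lt hlt').ne
      simpa [PiLp.inner_apply, dotProduct] using this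
    refine ⟨inner ℝ (b j) (WithLp.toLp 2 y), fun v => ?_⟩
    have h1 := b.sum_repr' (WithLp.toLp 2 y)
    rw [Finset.sum_eq_single j (fun i _ hi => by rw [h0 i hi, zero_smul]) (by simp)] at h1
    have := congrArg (fun z : EuclideanSpace ℝ V => z v) h1
    simpa using this.symm
  obtain ⟨t, ht⟩ := key c x le_rfl hx
  obtain ⟨s, hs⟩ := key 0 (fun _ => 1) hc (by simpa using Γ.lapMatrix_mulVec_const_eq_zero (R := ℝ))
  obtain ⟨u, v, huv⟩ := hne
  apply huv
  have hs0 : s ≠ 0 := by rintro rfl; simpa using hs u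
  rw [ht, ht, mul_left_cancel₀ hs0 ((hs u).symm.trans (hs v))]

/-! ### A congruence modulo a prime power -/

/-- Solvability of `j + i * (1 + s + ⋯ + s ^ (p - 1)) ≡ 0` modulo `p ^ m`. -/
theorem Int.exists_pow_dvd_add_mul_geom_sum {p m : ℕ} (hp : p.Prime) {s j : ℤ}
    (hs : (p : ℤ) ^ m ∣ s ^ p - 1) (hs1 : ¬ (p : ℤ) ^ m ∣ s - 1)
    (hj : (p : ℤ) ^ m ∣ j * (s - 1)) :
    (∃ i : ℤ, (p : ℤ) ^ m ∣ j + i * ∑ t ∈ Finset.range p, s ^ t) ∨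
      (p = 2 ∧ (p : ℤ) ^ m ∣ s + 1) := by
  have hpZ : Prime (p : ℤ) := Nat.prime_iff_prime_int.mp hp
  have hm : m ≠ 0 := by rintro rfl; simp at hs1
  have hpj : (p : ℤ) ∣ j := by
    by_contra h
    exact hs1 (IsCoprime.dvd_of_dvd_mul_left
      (((Prime.coprime_iff_not_dvd hpZ).mpr h).pow_left) hj)
  have hps : (p : ℤ) ∣ s - 1 := by
    have := Fact.mk hp
    have h1 : (p : ℤ) ∣ s ^ p - 1 := (dvd_pow_self _ hm).trans hs
    rw [← ZMod.intCast_zmod_eq_zero_iff_dvd] at h1 ⊢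
    simpa using h1
  -- If `p` divides the geometric sum exactly once, its cofactor is invertible modulo `p ^ m`, and
  -- `p ∣ j` makes the congruence solvable.
  have main : ∀ w : ℤ, ∑ t ∈ Finset.range p, s ^ t = p * w → ¬ (p : ℤ) ∣ w →
      ∃ i : ℤ, (p : ℤ) ^ m ∣ j + i * ∑ t ∈ Finset.range p, s ^ t := by
    intro w hw hpw
    obtain ⟨u, v, huv⟩ := ((Prime.coprime_iff_not_dvd hpZ).mpr hpw).pow_left (m := m)
    obtain ⟨j', rfl⟩ := hpj
    refine ⟨-j' * v, p * j' * u, ?_⟩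
    rw [hw]
    linear_combination (-(p : ℤ) * j') * huv
  rcases hp.eq_two_or_odd' with rfl | hodd
  · simp only [Finset.sum_range_succ, Finset.sum_range_zero, pow_zero, pow_one, zero_add,
      Nat.cast_ofNat, true_and] at *
    obtain ⟨r, hr⟩ := hps
    obtain rfl : s = 2 * r + 1 := by linarith
    rcases Int.even_or_odd' r with ⟨q, rfl | rfl⟩
    · exact Or.inl (main (2 * q + 1) (by ring) (by omega))
    · obtain ⟨l, rfl⟩ := Nat.exists_eq_succ_of_ne_zero hm
      rw [Nat.succ_eq_add_one, pow_succ'] at *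
      -- Here `s - 1` is twice an odd number, so one factor of `2` is lost when cancelling it; this
      -- applies to `j` and to `s + 1`.
      have h2 : ∀ z : ℤ, 2 * 2 ^ l ∣ z * (2 * (2 * q + 1)) → (2 : ℤ) ^ l ∣ z := by
        intro z hz
        rw [show z * (2 * (2 * q + 1)) = 2 * (z * (2 * q + 1)) by ring,
          mul_dvd_mul_iff_left two_ne_zero] at hz
        exact IsCoprime.dvd_of_dvd_mul_right
          (IsCoprime.pow_left (m := l) (x := 2) ⟨-q, 1, by ring⟩) hz
      obtain ⟨j', hj'⟩ := h2 j (by convert hj using 1; ring)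
      obtain ⟨e, he⟩ := h2 (2 * (2 * q + 1) + 1 + 1) (by convert hs using 1; ring)
      rcases Int.even_or_odd' e with ⟨f, rfl | rfl⟩
      · exact Or.inr ⟨f, by rw [he]; ring⟩
      · refine Or.inl ⟨j', j' * (f + 1), ?_⟩
        rw [add_comm 1 (2 * (2 * q + 1) + 1 : ℤ), he, hj']
        ring
  · left
    obtain ⟨r, hr⟩ := hps
    obtain rfl : s = 1 + p * r := by linarith
    obtain ⟨q, hq⟩ := odd_sq_dvd_geom_sum₂_sub (a := (1 : ℤ)) r hodd
    simp only [one_pow, mul_one] at hq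
    refine main (1 + p * q) (by linear_combination hq) ?_
    intro h
    exact hpZ.not_isUnit (isUnit_of_dvd_one ((dvd_add_left (dvd_mul_right _ _)).mp h))

/-! ### Graphs with vertices joined to everything -/

/-- Removing a set `D` of vertices that are joined to everything disconnects the graph if a set
`C` is separated from its complement outside `D`; then no smaller set does so. -/
theorem vertexConnectivity_eq_card {V : Type*} [Fintype V] {Γ : SimpleGraph V}
    {D C : Finset V} (hD : ∀ d ∈ D, ∀ v, d ≠ v → Γ.Adj d v) (hCD : Disjoint C D) {u v : V}
    (hu : u ∈ C) (hvC : v ∉ C) (hvD : v ∉ D)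
    (hC : ∀ x ∈ C, ∀ y, y ∉ C → y ∉ D → ¬ Γ.Adj x y) : vertexConnectivity Γ = D.card := by
  classical
  have huD : u ∉ D := Finset.disjoint_left.mp hCD hu
  have huv : u ≠ v := fun h => hvC (h ▸ hu)
  have hmem : D.card ∈ {k : ℕ | ∃ S : Finset V, S.card = k ∧
      (¬ (Γ.induce ((S : Set V)ᶜ)).Preconnected ∨ ((S : Set V)ᶜ).ncard = 1)} := by
    refine ⟨D, rfl, Or.inl fun hpre => ?_⟩
    have key : ∀ {x y : ((D : Set V)ᶜ : Set V)},
        (Γ.induce ((D : Set V)ᶜ)).Walk x y → (x : V) ∈ C → (y : V) ∈ C := by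
      intro x y w
      induction w with
      | nil => exact id
      | @cons a b c hab _ ih =>
        intro ha
        refine ih ?_
        by_contra hb
        exact hC a ha b hb (fun h => b.2 h) (by simpa using hab)
    obtain ⟨w⟩ := hpre ⟨u, by simpa using huD⟩ ⟨v, by simpa using hvD⟩
    exact hvC (key w hu)
  refine le_antisymm (Nat.sInf_le hmem) (le_csInf ⟨_, hmem⟩ ?_)
  rintro _ ⟨S, rfl, hS⟩
  by_contra! hlt
  obtain ⟨d, hd, hdS⟩ := Finset.exists_mem_notMem_of_card_lt_card hlt
  rcases hS with hS | hS
  · refine hS fun x y => ?_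
    have hr : ∀ z : ((S : Set V)ᶜ : Set V),
        (Γ.induce ((S : Set V)ᶜ)).Reachable ⟨d, by simpa using hdS⟩ z := by
      intro z
      by_cases hz : d = z
      · have : (⟨d, by simpa using hdS⟩ : ((S : Set V)ᶜ : Set V)) = z := Subtype.ext hz
        rw [this]
      · exact SimpleGraph.Adj.reachable (by simpa using hD d hd z hz)
    exact (hr x).symm.trans (hr y)
  · rw [← Finset.coe_compl, Set.ncard_coe_finset, Finset.card_compl] at hS
    -- Since `u` and `v` lie outside `D`, leaving one vertex costs at least `|D| + 1` removals.
    have h1 : (insert u (insert v D)).card ≤ Fintype.card V := Finset.card_le_univ _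
    rw [Finset.card_insert_of_notMem (by simp [huv, huD]), Finset.card_insert_of_notMem hvD] at h1
    omega

theorem vertexConnectivity_lt_card {V : Type*} [Fintype V] [Nonempty V] (Γ : SimpleGraph V) :
    vertexConnectivity Γ < Fintype.card V := by
  classical
  obtain ⟨v⟩ := ‹Nonempty V›
  have hmem : Fintype.card V - 1 ∈ {k : ℕ | ∃ S : Finset V, S.card = k ∧
      (¬ (Γ.induce ((S : Set V)ᶜ)).Preconnected ∨ ((S : Set V)ᶜ).ncard = 1)} :=
    ⟨{v}ᶜ, by rw [Finset.card_compl, Finset.card_singleton], Or.inr (by simp)⟩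
  exact (Nat.sInf_le hmem).trans_lt (Nat.sub_lt (Fintype.card_pos_iff.mpr ⟨v⟩) one_pos)

open Classical in
theorem SimpleGraph.lapMatrix_mulVec_eq_sum {V : Type*} [Fintype V] (Γ : SimpleGraph V)
    (x : V → ℝ) (v : V) :
    (Γ.lapMatrix ℝ).mulVec x v = ∑ w, if Γ.Adj v w then x v - x w else 0 := by
  rw [lapMatrix_mulVec_apply, ← Finset.sum_filter, Finset.sum_sub_distrib,
    Finset.sum_const, nsmul_eq_mul, ← neighborFinset_eq_filter, card_neighborFinset_eq_degree]

open Classical in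
/-- Vertices joined to everything bound the algebraic connectivity from below. -/
theorem card_le_algebraicConnectivity {V : Type*} [Fintype V] [Nontrivial V] {Γ : SimpleGraph V}
    {D : Finset V} (hD : ∀ d ∈ D, ∀ v, d ≠ v → Γ.Adj d v) :
    (D.card : ℝ) ≤ algebraicConnectivity Γ := by
  refine le_algebraicConnectivity fun μ x hμ hx => ?_
  rcases D.eq_empty_or_nonempty with rfl | ⟨d₀, hd₀⟩
  · rw [Finset.card_empty, Nat.cast_zero] at hμ
    have hpos := (SimpleGraph.posSemidef_lapMatrix ℝ Γ).dotProduct_mulVec_nonneg x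
    rw [hx, star_trivial, dotProduct_smul, smul_eq_mul] at hpos
    have h0 : x ⬝ᵥ x = 0 := by
      refine le_antisymm ?_ (by simpa using dotProduct_star_self_nonneg x)
      by_contra! h
      nlinarith
    intro u v
    rw [dotProduct_self_eq_zero.mp h0]; rfl
  have hlap : ∀ v, ∑ w, (if Γ.Adj v w then x v - x w else 0) = μ * x v := fun v => by
    rw [← Γ.lapMatrix_mulVec_eq_sum, hx]; rfl
  have hdom : ∀ d ∈ D, ∑ w, (x d - x w) = μ * x d := by
    intro d hd
    rw [← hlap d]
    refine Finset.sum_congr rfl fun w _ => ?_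
    by_cases h : d = w
    · simp [h]
    · simp [hD d hd w h]
  by_cases hμ0 : μ = 0
  · subst hμ0
    rw [zero_smul, SimpleGraph.lapMatrix_mulVec_eq_zero_iff_forall_adj] at hx
    have : ∀ v, x d₀ = x v := by
      intro v
      by_cases h : d₀ = v
      · rw [h]
      · exact hx _ _ (hD d₀ hd₀ v h)
    intro u v
    rw [← this u, ← this v]
  have hsum : ∑ v, x v = 0 := by
    have h := (Γ.isHermitian_lapMatrix ℝ).dotProduct_eq_zero_of_mulVec_eq_smul hx
      (y := fun _ => 1) (b := 0) (by simpa using Γ.lapMatrix_mulVec_const_eq_zero (R := ℝ)) hμ0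
    simpa [dotProduct] using h
  have hcard : (D.card : ℝ) ≤ Fintype.card V := by exact_mod_cast D.card_le_univ
  -- At `d` the eigenvalue equation reads `n * x d = μ * x d`, and `μ < |D| ≤ n`.
  have hxD : ∀ d ∈ D, x d = 0 := by
    intro d hd
    have h := hdom d hd
    rw [Finset.sum_sub_distrib, hsum, Finset.sum_const, Finset.card_univ, nsmul_eq_mul,
      sub_zero] at h
    have h2 : ((Fintype.card V : ℝ) - μ) * x d = 0 := by linear_combination h
    exact (mul_eq_zero.mp h2).resolve_left (by linarith)
  obtain ⟨v, -, hv⟩ := Finset.exists_max_image Finset.univ x Finset.univ_nonempty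
  -- At a positive maximum the neighbours in `D` alone contribute `|D| * x v`, more than `μ * x v`.
  have hle : x v ≤ 0 := by
    by_contra! hpos
    have hvD : v ∉ D := fun h => hpos.ne' (hxD v h)
    have h1 : ∑ w ∈ D, x v ≤ ∑ w, (if Γ.Adj v w then x v - x w else 0) := by
      refine le_trans (Finset.sum_le_sum fun w hw => ?_)
        (Finset.sum_le_sum_of_subset_of_nonneg (Finset.subset_univ D) fun w _ _ => ?_)
      · rw [if_pos (hD w hw v (fun h => hvD (h ▸ hw))).symm, hxD w hw, sub_zero]
      · split_ifs
        · exact sub_nonneg.mpr (hv w (Finset.mem_univ w))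
        · exact le_rfl
    rw [hlap, Finset.sum_const, nsmul_eq_mul] at h1
    exact absurd (le_of_mul_le_mul_right h1 hpos) (not_le.mpr hμ)
  have hall : ∀ w, x w = 0 := fun w =>
    (Finset.sum_eq_zero_iff_of_nonpos
      (fun i _ => (hv i (Finset.mem_univ i)).trans hle)).mp hsum w (Finset.mem_univ w)
  intro u w
  rw [hall, hall]

-- The test vector sums to zero, which settles the rows in `D`; in any other row only the neighbours
-- in `D` contribute, giving `|D| * x w`.
open Classical in
theorem algebraicConnectivity_eq_card {V : Type*} [Fintype V] [Nontrivial V] {Γ : SimpleGraph V}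
    {D C : Finset V} (hD : ∀ d ∈ D, ∀ v, d ≠ v → Γ.Adj d v) (hCD : Disjoint C D) {u v : V}
    (hu : u ∈ C) (hvC : v ∉ C) (hvD : v ∉ D)
    (hC : ∀ x ∈ C, ∀ y, y ∉ C → y ∉ D → ¬ Γ.Adj x y) :
    algebraicConnectivity Γ = D.card := by
  refine le_antisymm ?_ (card_le_algebraicConnectivity hD)
  set E : Finset V := (C ∪ D)ᶜ with hE
  have hEC : ∀ {w}, w ∈ E → w ∉ C := fun hw h => by simp [hE, h] at hw
  have hED : ∀ {w}, w ∈ E → w ∉ D := fun hw h => by simp [hE, h] at hw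
  have hCD' : ∀ {w}, w ∈ C → w ∉ D := fun h => Finset.disjoint_left.mp hCD h
  have hcase : ∀ w, w ∈ C ∨ w ∈ D ∨ w ∈ E := by
    intro w
    by_cases h1 : w ∈ C <;> by_cases h2 : w ∈ D <;> simp [hE, h1, h2]
  let x : V → ℝ := fun w => if w ∈ C then E.card else if w ∈ E then - (C.card : ℝ) else 0
  have hxC : ∀ w ∈ C, x w = E.card := fun w hw => if_pos hw
  have hxE : ∀ w ∈ E, x w = - (C.card : ℝ) := fun w hw => by simp [x, hEC hw, hw]
  have hxD : ∀ w ∈ D, x w = 0 := fun w hw => by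
    simp only [x, if_neg (fun h => hCD' h hw : w ∉ C), if_neg (fun h => hED h hw : w ∉ E)]
  have hvE : v ∈ E := by simp [hE, hvC, hvD]
  have hCpos : (0 : ℝ) < C.card := by exact_mod_cast Finset.card_pos.mpr ⟨u, hu⟩
  have hxsum : ∑ w, x w = 0 := by
    have h : ∀ w, x w = (if w ∈ C then (E.card : ℝ) else 0) +
        (if w ∈ E then -(C.card : ℝ) else 0) := by
      intro w
      by_cases h1 : w ∈ C
      · simp only [x, if_pos h1, if_neg (fun h => hEC h h1 : w ∉ E), add_zero]
      · simp [x, h1]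
    rw [Finset.sum_congr rfl fun w _ => h w, Finset.sum_add_distrib]
    simp
    ring
  refine algebraicConnectivity_le (Nat.cast_nonneg _) (x := x) ?_ ⟨u, v, ?_⟩
  · funext w
    rw [Γ.lapMatrix_mulVec_eq_sum, Pi.smul_apply, smul_eq_mul]
    by_cases hw : w ∈ D
    · rw [hxD w hw, mul_zero]
      refine (Finset.sum_congr rfl fun z _ => ?_).trans
        (by rw [Finset.sum_neg_distrib, hxsum, neg_zero] : ∑ z, -x z = 0)
      by_cases h : w = z
      · simp [← h, hxD w hw]
      · simp [hD w hw z h]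
    · rw [← nsmul_eq_mul, ← Finset.sum_const, ← Finset.sum_subset (Finset.subset_univ D)]
      · refine Finset.sum_congr rfl fun z hz => ?_
        rw [if_pos (hD z hz w fun h => hw (h ▸ hz)).symm, hxD z hz, sub_zero]
      · intro z _ hz
        split_ifs with hadj
        · rcases (hcase w).imp_right (Or.resolve_left · hw) with h1 | h1 <;>
            rcases (hcase z).imp_right (Or.resolve_left · hz) with h2 | h2
          · rw [hxC w h1, hxC z h2, sub_self]
          · exact absurd hadj (hC w h1 z (hEC h2) hz)
          · exact absurd hadj.symm (hC z h2 w (hEC h1) hw)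
          · rw [hxE w h1, hxE z h2, sub_self]
        · rfl
  · rw [hxC u hu, hxE v hvE]
    have : (0 : ℝ) ≤ E.card := Nat.cast_nonneg _
    linarith

/-! ### Finite `p`-groups with one subgroup of order `p` -/

theorem IsPGroup.exists_orderOf_pow_eq_prime {p : ℕ} [Fact p.Prime] {G : Type*} [Group G]
    (hG : IsPGroup p G) {g : G} (hg : g ≠ 1) : ∃ k : ℕ, 0 < k ∧ orderOf (g ^ k) = p := by
  obtain ⟨k, hk⟩ := IsPGroup.iff_orderOf.mp hG g
  have hp := (Fact.out : p.Prime).pos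
  have hk0 : k ≠ 0 := fun h => hg (by rwa [h, pow_zero, orderOf_eq_one_iff] at hk)
  obtain ⟨l, rfl⟩ := Nat.exists_eq_succ_of_ne_zero hk0
  refine ⟨p ^ l, pow_pos hp l, ?_⟩
  rw [orderOf_pow_of_dvd (pow_pos hp l).ne' (hk ▸ pow_dvd_pow p l.le_succ), hk, Nat.succ_eq_add_one,
    pow_succ, Nat.mul_div_cancel_left _ (pow_pos hp l)]

/-- An element outside a subgroup has a power just outside the subgroup. -/
theorem IsPGroup.exists_pow_notMem_of_notMem {p : ℕ} {G : Type*} [Group G] (hG : IsPGroup p G)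
    {A : Subgroup G} {y : G} (hy : y ∉ A) :
    ∃ k : ℕ, y ^ p ^ k ∉ A ∧ (y ^ p ^ k) ^ p ∈ A := by
  classical
  have hex : ∃ k, y ^ p ^ k ∈ A := (hG y).imp fun k hk => by rw [hk]; exact A.one_mem
  have h0 : Nat.find hex ≠ 0 := fun h => hy (by simpa [h] using Nat.find_spec hex)
  obtain ⟨l, hl⟩ := Nat.exists_eq_succ_of_ne_zero h0
  refine ⟨l, Nat.find_min hex (hl ▸ l.lt_succ_self), ?_⟩
  rw [← pow_mul, ← pow_succ, ← Nat.succ_eq_add_one, ← hl]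
  exact Nat.find_spec hex

theorem zpow_mul_eq_mul_zpow {G : Type*} [Group G] {a x : G} {s : ℤ} (h : a * x = x * a ^ s)
    (i : ℤ) : a ^ i * x = x * a ^ (s * i) := by
  have h1 : x⁻¹ * a * x = a ^ s := by rw [mul_assoc, h, inv_mul_cancel_left]
  have h2 : x⁻¹ * a ^ i * x = a ^ (s * i) := by
    rw [zpow_mul, ← h1]
    simpa using (conj_zpow (i := i) (a := x⁻¹) (b := a)).symm
  rw [← h2]
  group

theorem zpow_mul_pow_eq {G : Type*} [Group G] {a x : G} {s : ℤ} (h : a * x = x * a ^ s)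
    (n : ℕ) (i : ℤ) : a ^ i * x ^ n = x ^ n * a ^ (s ^ n * i) := by
  induction n with
  | zero => simp
  | succ n ih =>
    rw [pow_succ, ← mul_assoc, ih, mul_assoc, zpow_mul_eq_mul_zpow h, ← mul_assoc, pow_succ]
    ring_nf

/-- Moving a power of `a` past `x` multiplies its exponent by `s`, so the exponents accumulate a
geometric sum. -/
theorem mul_zpow_pow_eq {G : Type*} [Group G] {a x : G} {s : ℤ} (h : a * x = x * a ^ s)
    (n : ℕ) (i : ℤ) :
    (x * a ^ i) ^ n = x ^ n * a ^ (i * ∑ t ∈ Finset.range n, s ^ t) := by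
  induction n with
  | zero => simp
  | succ n ih =>
    rw [pow_succ', ih, ← mul_assoc, mul_assoc x, zpow_mul_pow_eq h, Finset.sum_range_succ,
      ← mul_assoc, ← pow_succ', mul_assoc, ← zpow_add]
    ring_nf

/-- In a group with one subgroup of order `p`, an element whose `p`-th power lies in a normal
cyclic `p`-subgroup either centralizes or (for `p = 2`) inverts that subgroup. -/
theorem inverts_of_unique_prime_order {p m : ℕ} (hp : p.Prime) {G : Type*} [Group G]
    (hU : ∀ x y : G, orderOf x = p → orderOf y = p → y ∈ Subgroup.zpowers x)
    {a x : G} (ha : orderOf a = p ^ m) (hm : m ≠ 0) {s : ℤ} (hs : a * x = x * a ^ s)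
    (hx : x ∉ Subgroup.zpowers a) (hxp : x ^ p ∈ Subgroup.zpowers a) (hc : a * x ≠ x * a) :
    p = 2 ∧ a * x = x * a⁻¹ := by
  have hz : ∀ i : ℤ, a ^ i = 1 ↔ (p : ℤ) ^ m ∣ i := fun i => by
    rw [← orderOf_dvd_iff_zpow_eq_one, ha, Nat.cast_pow]
  obtain ⟨j, hj⟩ := Subgroup.mem_zpowers_iff.mp hxp
  -- `x ^ p` is a power of `a`, so it commutes with `a`.
  have h1 : (p : ℤ) ^ m ∣ s ^ p - 1 := by
    have h := zpow_mul_pow_eq hs p 1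
    rw [← hj, ← zpow_add, ← zpow_add, ← mul_inv_eq_one, ← zpow_neg, ← zpow_add, hz,
      ← dvd_neg] at h
    rwa [show -(1 + j + -(j + s ^ p * 1)) = s ^ p - 1 by ring] at h
  have h2 : ¬ (p : ℤ) ^ m ∣ s - 1 := by
    rw [← hz, zpow_sub, zpow_one, mul_inv_eq_one]
    exact fun h => hc (by rw [hs, h])
  -- `x` commutes with its own power `x ^ p = a ^ j`.
  have h3 : (p : ℤ) ^ m ∣ j * (s - 1) := by
    have h := zpow_mul_eq_mul_zpow hs j
    rw [hj, (Commute.pow_self x p).eq, ← hj, mul_right_inj, ← mul_inv_eq_one, ← zpow_neg,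
      ← zpow_add, hz, ← dvd_neg] at h
    rwa [show -(j + -(s * j)) = j * (s - 1) by ring] at h
  rcases Int.exists_pow_dvd_add_mul_geom_sum hp h1 h2 h3 with ⟨i, hi⟩ | ⟨h, hs'⟩
  · exfalso
    rw [← hz, zpow_add, hj, ← mul_zpow_pow_eq hs] at hi
    have hnot : x * a ^ i ∉ Subgroup.zpowers a := fun h =>
      hx ((Subgroup.mul_mem_cancel_right _ (Subgroup.zpow_mem_zpowers a i)).mp h)
    have hord : orderOf (x * a ^ i) = p := by
      have := Fact.mk hp
      exact orderOf_eq_prime hi fun h => hnot (h ▸ Subgroup.one_mem _)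
    obtain ⟨l, rfl⟩ := Nat.exists_eq_succ_of_ne_zero hm
    have hapos : 0 < p ^ l := pow_pos hp.pos l
    have haord : orderOf (a ^ p ^ l) = p := by
      rw [orderOf_pow_of_dvd hapos.ne' (ha ▸ pow_dvd_pow p l.le_succ), ha, Nat.succ_eq_add_one,
        pow_succ, Nat.mul_div_cancel_left _ hapos]
    exact hnot (Subgroup.zpowers_le.mpr (Subgroup.pow_mem _ (Subgroup.mem_zpowers a) _)
      (hU _ _ haord hord))
  · refine ⟨h, ?_⟩
    rw [hs, mul_right_inj, ← mul_inv_eq_one, inv_inv, ← zpow_add_one, hz]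
    exact hs'

/-- A commutative subgroup of a finite `p`-group with one subgroup of order `p` is cyclic. -/
theorem IsPGroup.exists_zpowers_eq_of_unique_prime_order {p : ℕ} [Fact p.Prime] {G : Type*}
    [Group G] [Finite G] (hG : IsPGroup p G)
    (hU : ∀ x y : G, orderOf x = p → orderOf y = p → y ∈ Subgroup.zpowers x) (A : Subgroup G)
    (hA : ∀ x ∈ A, ∀ y ∈ A, x * y = y * x) : ∃ a, Subgroup.zpowers a = A := by
  have hp : p.Prime := Fact.out
  obtain ⟨⟨a, haA⟩, hmax⟩ := Finite.exists_max fun g : A => orderOf (g : G)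
  refine ⟨a, le_antisymm (Subgroup.zpowers_le.mpr haA) fun y hyA => ?_⟩
  by_contra hy
  obtain ⟨k, hxn, hxp⟩ := hG.exists_pow_notMem_of_notMem hy
  set x := y ^ p ^ k
  have hxA : x ∈ A := A.pow_mem hyA _
  obtain ⟨m, ham⟩ := IsPGroup.iff_orderOf.mp hG a
  obtain ⟨j, hj⟩ := Subgroup.mem_zpowers_iff.mp hxp
  have hcomm : Commute a x := hA a haA x hxA
  by_cases hpj : (p : ℤ) ∣ j
  -- Dividing `x` by the `p`-th root `a ^ i` of `x ^ p` gives an element of order `p` outside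
  -- `zpowers a`.
  · obtain ⟨i, rfl⟩ := hpj
    have hw : (x * a ^ (-i)) ^ p = 1 := by
      rw [(hcomm.symm.zpow_right _).mul_pow, ← hj, ← zpow_natCast, ← zpow_mul, ← zpow_add]
      ring_nf
      simp
    have hnot : x * a ^ (-i) ∉ Subgroup.zpowers a := fun h =>
      hxn ((Subgroup.mul_mem_cancel_right _ (Subgroup.zpow_mem_zpowers a _)).mp h)
    have hord := orderOf_eq_prime hw fun h => hnot (h ▸ Subgroup.one_mem _)
    have ha1 : a ≠ 1 := by
      rintro rfl
      have := hmax ⟨x * 1 ^ (-i), by simpa using hxA⟩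
      simp only [hord, orderOf_one] at this
      exact absurd this (not_le.mpr hp.one_lt)
    obtain ⟨l, -, hl⟩ := hG.exists_orderOf_pow_eq_prime ha1
    exact hnot (Subgroup.zpowers_le.mpr (Subgroup.pow_mem _ (Subgroup.mem_zpowers a) _)
      (hU _ _ hl hord))
  -- Now `x ^ p` generates `zpowers a`, so `zpowers x` is strictly larger, against maximality.
  · have hcop : IsCoprime ((p : ℤ) ^ m) j :=
      ((Prime.coprime_iff_not_dvd (Nat.prime_iff_prime_int.mp hp)).mpr hpj).pow_left
    obtain ⟨u, v, huv⟩ := hcop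
    have hax : x ^ ((p : ℤ) * v) = a := by
      have h1 : a ^ ((p : ℤ) ^ m) = 1 := by
        rw [← Nat.cast_pow, zpow_natCast, ← ham, pow_orderOf_eq_one]
      rw [zpow_mul, zpow_natCast, ← hj, ← zpow_mul]
      calc a ^ (j * v) = a ^ (u * (p : ℤ) ^ m + v * j) := by
            rw [mul_comm u, zpow_add, zpow_mul a (_ ^ _), h1, one_zpow, one_mul,
              mul_comm]
        _ = a := by rw [huv, zpow_one]
    have hle : Subgroup.zpowers a ≤ Subgroup.zpowers x :=
      Subgroup.zpowers_le.mpr (Subgroup.mem_zpowers_iff.mpr ⟨_, hax⟩)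
    have heq : Subgroup.zpowers a = Subgroup.zpowers x := by
      refine Subgroup.eq_of_le_of_card_ge hle ?_
      rw [Nat.card_zpowers, Nat.card_zpowers]
      exact hmax ⟨x, hxA⟩
    exact hxn (heq ▸ Subgroup.mem_zpowers x)

/-- A nilpotent group with finitely many subgroups has a normal commutative subgroup that contains
its centralizer. -/
theorem Group.IsNilpotent.exists_normal_commutative_self_centralizing {G : Type*} [Group G]
    [Finite G] [Group.IsNilpotent G] : ∃ A : Subgroup G, A.Normal ∧
      (∀ x ∈ A, ∀ y ∈ A, x * y = y * x) ∧ ∀ g, (∀ x ∈ A, x * g = g * x) → g ∈ A := by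
  classical
  obtain ⟨A, hA⟩ := Set.Finite.exists_maximal
    (Set.toFinite {A : Subgroup G | A.Normal ∧ ∀ x ∈ A, ∀ y ∈ A, x * y = y * x})
    ⟨⊥, Subgroup.normal_bot, by simp⟩
  obtain ⟨⟨hN, hc⟩, hmax⟩ := hA
  refine ⟨A, hN, hc, fun g hg => ?_⟩
  by_contra hgA
  obtain ⟨n, hn⟩ := Subgroup.nilpotent_iff_lowerCentralSeries.mp ‹Group.IsNilpotent G›
  let C := Subgroup.centralizer (A : Set G)
  have hCN : C.Normal := inferInstance
  -- An element `c` of `C` in the last term not inside `A` is central modulo `A`; adjoining it to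
  -- `A` contradicts maximality.
  have hex : ∃ k, C ⊓ (⊤ : Subgroup G).lowerCentralSeries k ≤ A := ⟨n, by simp [hn]⟩
  have hgC : g ∈ C := Subgroup.mem_centralizer_iff.mpr hg
  have h0 : Nat.find hex ≠ 0 := fun h => by
    have := Nat.find_spec hex
    rw [h] at this
    exact hgA (this ⟨hgC, Subgroup.mem_top g⟩)
  obtain ⟨l, hl⟩ := Nat.exists_eq_succ_of_ne_zero h0
  obtain ⟨c, ⟨hcC, hcl⟩, hcA⟩ :=
    SetLike.not_le_iff_exists.mp (Nat.find_min hex (hl ▸ l.lt_succ_self))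
  have hcomm : ∀ h : G, c * h * c⁻¹ * h⁻¹ ∈ A := by
    intro h
    refine (hl ▸ Nat.find_spec hex) ⟨?_, ?_⟩
    · rw [mul_assoc c, mul_assoc c]
      exact C.mul_mem hcC (hCN.conj_mem _ (C.inv_mem hcC) h)
    · exact Subgroup.commutator_mem_commutator hcl (Subgroup.mem_top h)
  have hcent : (c : G ⧸ A) ∈ Subgroup.center (G ⧸ A) := by
    refine Subgroup.mem_center_iff.mpr fun q => ?_
    obtain ⟨h, rfl⟩ := QuotientGroup.mk_surjective q
    rw [← QuotientGroup.mk_mul, ← QuotientGroup.mk_mul, QuotientGroup.eq]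
    refine hN.mem_comm ?_
    simpa [mul_assoc] using hcomm h
  have hZ : (Subgroup.zpowers (c : G ⧸ A)).Normal :=
    ⟨fun z hz g => by
      have hzc := Subgroup.mem_center_iff.mp (Subgroup.zpowers_le.mpr hcent hz) g
      rwa [hzc, mul_inv_cancel_right]⟩
  let B := (Subgroup.zpowers (c : G ⧸ A)).comap (QuotientGroup.mk' A)
  have hBmem : ∀ b ∈ B, ∃ k : ℤ, ∃ x ∈ A, b = c ^ k * x := by
    intro b hb
    obtain ⟨k, hk⟩ := Subgroup.mem_zpowers_iff.mp (Subgroup.mem_comap.mp hb)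
    rw [QuotientGroup.mk'_apply, ← QuotientGroup.mk_zpow, QuotientGroup.eq] at hk
    exact ⟨k, _, hk, by simp⟩
  have hAB : A ≤ B := fun x hx => by
    rw [Subgroup.mem_comap, QuotientGroup.mk'_apply, (QuotientGroup.eq_one_iff x).mpr hx]
    exact Subgroup.one_mem _
  have hB : B ∈ {A : Subgroup G | A.Normal ∧ ∀ x ∈ A, ∀ y ∈ A, x * y = y * x} := by
    refine ⟨inferInstance, fun b hb d hd => ?_⟩
    obtain ⟨k, x, hx, rfl⟩ := hBmem b hb
    obtain ⟨l, y, hy, rfl⟩ := hBmem d hd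
    have hcx : ∀ z ∈ A, Commute c z := fun z hz => (Subgroup.mem_centralizer_iff.mp hcC z hz).symm
    exact (((Commute.refl c).zpow_zpow k l).mul_right ((hcx y hy).zpow_left k)).mul_left
      (((hcx x hx).zpow_left l).symm.mul_right (hc x hx y hy))
  exact hcA (hmax hB hAB (Subgroup.mem_comap.mpr (Subgroup.mem_zpowers _)))

/-- Lets powers of `a` be indexed by `ZMod n`, as the constructors of `QuaternionGroup` are. -/
theorem ZMod.exists_hom_zpow {G : Type*} [Group G] {a : G} {n : ℕ} (ha : orderOf a = n) :
    ∃ φ : ZMod n → G, (∀ i : ℤ, φ i = a ^ i) ∧ (∀ i j, φ (i + j) = φ i * φ j) ∧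
      ∀ i, φ i = 1 → i = 0 := by
  subst ha
  have key : ∀ i j : ℤ, (i : ZMod (orderOf a)) = j → a ^ i = a ^ j := by
    intro i j hij
    rwa [zpow_eq_zpow_iff_modEq, ← ZMod.intCast_eq_intCast_iff]
  have hφ : ∀ i : ℤ, a ^ (((i : ZMod (orderOf a)).cast : ℤ)) = a ^ i := fun i => key _ _ (by simp)
  refine ⟨fun i => a ^ (i.cast : ℤ), hφ, fun i j => ?_, fun i hi => ?_⟩
  · rw [← zpow_add]
    exact key _ _ (by simp)
  · rw [← orderOf_dvd_iff_zpow_eq_one, ← ZMod.intCast_zmod_eq_zero_iff_dvd] at hi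
    simpa using hi

open QuaternionGroup in
/-- Recognition of quaternion groups by their presentation. -/
theorem QuaternionGroup.nonempty_mulEquiv {n : ℕ} {G : Type*} [Group G] {b y : G}
    (ha : orderOf b = 2 * n) (hy : y ∉ Subgroup.zpowers b) (hby : b * y = y * b⁻¹)
    (hy2 : y * y = b ^ n) (hcover : ∀ g : G, g ∉ Subgroup.zpowers b →
      y⁻¹ * g ∈ Subgroup.zpowers b) : Nonempty (G ≃* QuaternionGroup n) := by
  obtain ⟨φ, h1, h2, h3⟩ := ZMod.exists_hom_zpow ha
  have hφn : φ n = y * y := by rw [hy2, ← zpow_natCast, ← h1, Int.cast_natCast]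
  have hmem : ∀ i, φ i ∈ Subgroup.zpowers b := by
    intro i
    obtain ⟨k, rfl⟩ := ZMod.intCast_surjective i
    exact h1 k ▸ Subgroup.zpow_mem_zpowers b k
  have hφy : ∀ i, φ i * y = y * φ (-i) := by
    intro i
    obtain ⟨k, rfl⟩ := ZMod.intCast_surjective i
    rw [← Int.cast_neg, h1, h1, zpow_mul_eq_mul_zpow (s := -1) (by rw [hby, zpow_neg_one]),
      neg_one_mul]
  let f : QuaternionGroup n →* G := MonoidHom.mk'
    (fun q => match q with
      | a i => φ i
      | xa i => y * φ i) <| by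
    rintro (i | i) (j | j)
    · simp only [a_mul_a, h2]
    · simp only [a_mul_xa]
      rw [← mul_assoc, hφy, mul_assoc, ← h2, neg_add_eq_sub]
    · simp only [xa_mul_a, h2, mul_assoc]
    · simp only [xa_mul_xa]
      rw [mul_assoc y, ← mul_assoc (φ i), hφy, mul_assoc y, ← h2, ← mul_assoc, ← hφn, ← h2]
      congr 1
      ring
  refine ⟨(MulEquiv.ofBijective f ⟨(injective_iff_map_eq_one f).mpr ?_, fun g => ?_⟩).symm⟩
  · rintro (i | i) hi
    · rw [h3 i hi, a_zero]
    · refine absurd ?_ hy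
      rw [eq_inv_of_mul_eq_one_left (show y * φ i = 1 from hi)]
      exact Subgroup.inv_mem _ (hmem i)
  · by_cases hg : g ∈ Subgroup.zpowers b
    · obtain ⟨k, rfl⟩ := Subgroup.mem_zpowers_iff.mp hg
      exact ⟨a k, h1 k⟩
    · obtain ⟨k, hk⟩ := Subgroup.mem_zpowers_iff.mp (hcover g hg)
      refine ⟨xa k, ?_⟩
      change y * φ k = g
      rw [h1, hk, mul_inv_cancel_left]

/-- A finite `p`-group with at most one subgroup of order `p` is cyclic or generalized
quaternion. -/
theorem IsPGroup.isCyclic_or_isGeneralizedQuaternion {p : ℕ} [Fact p.Prime] {G : Type*} [Group G]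
    [Finite G] (hG : IsPGroup p G)
    (hU : ∀ x y : G, orderOf x = p → orderOf y = p → y ∈ Subgroup.zpowers x) :
    IsCyclic G ∨ IsGeneralizedQuaternion G := by
  have hp : p.Prime := Fact.out
  have := hG.isNilpotent
  obtain ⟨A, hN, hc, hself⟩ :=
    Group.IsNilpotent.exists_normal_commutative_self_centralizing (G := G)
  obtain ⟨a, rfl⟩ := hG.exists_zpowers_eq_of_unique_prime_order hU A hc
  refine or_iff_not_imp_left.mpr fun hcyc => ?_
  have hself' : ∀ g, a * g = g * a → g ∈ Subgroup.zpowers a := by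
    intro g hg
    refine hself g fun x hx => ?_
    obtain ⟨k, rfl⟩ := Subgroup.mem_zpowers_iff.mp hx
    exact Commute.zpow_left (show Commute a g from hg) k
  have hact : ∀ g, ∃ s : ℤ, a * g = g * a ^ s := by
    intro g
    obtain ⟨s, hs⟩ := Subgroup.mem_zpowers_iff.mp
      (hN.conj_mem _ (Subgroup.mem_zpowers a) g⁻¹)
    exact ⟨s, by rw [hs]; group⟩
  obtain ⟨y, hy⟩ : ∃ y, y ∉ Subgroup.zpowers a := by
    by_contra! h
    exact hcyc ⟨a, h⟩
  obtain ⟨m, hm⟩ := IsPGroup.iff_orderOf.mp hG a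
  have hm0 : m ≠ 0 := by
    rintro rfl
    rw [pow_zero, orderOf_eq_one_iff] at hm
    exact hy (hself' y (by rw [hm, one_mul, mul_one]))
  have hinv : ∀ g, g ∉ Subgroup.zpowers a → g ^ p ∈ Subgroup.zpowers a →
      p = 2 ∧ a * g = g * a⁻¹ := fun g hg hgp =>
    inverts_of_unique_prime_order hp hU hm hm0 (hact g).choose_spec hg hgp
      fun h => hg (hself' g h)
  obtain rfl : p = 2 := by
    obtain ⟨k, h1, h2⟩ := hG.exists_pow_notMem_of_notMem hy
    exact (hinv _ h1 h2).1
  have hdvd : ∀ i : ℤ, a ^ i = 1 ↔ (2 : ℤ) ^ m ∣ i := fun i => by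
    rw [← orderOf_dvd_iff_zpow_eq_one, hm, Nat.cast_pow, Nat.cast_ofNat]
  -- If `a` had order `2`, inverting it would mean commuting with it.
  obtain ⟨k, rfl⟩ : ∃ k, m = k + 2 := by
    obtain ⟨k, h1, h2⟩ := hG.exists_pow_notMem_of_notMem hy
    refine ⟨m - 2, ?_⟩
    have hm1 : m ≠ 1 := by
      rintro rfl
      refine h1 (hself' _ ?_)
      rw [(hinv _ h1 h2).2, inv_eq_of_mul_eq_one_left]
      rw [← pow_two, ← pow_one 2, ← hm, pow_orderOf_eq_one]
    omega
  have hinv' : ∀ g, g ∉ Subgroup.zpowers a → a * g = g * a⁻¹ := by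
    intro g hg
    obtain ⟨l, h1, h2⟩ := hG.exists_pow_notMem_of_notMem hg
    rcases l with _ | l
    · rw [pow_zero, pow_one] at h1 h2
      exact (hinv g h1 h2).2
    -- Otherwise `g ^ 2 ^ l` acts by some `s` with `s ^ 2 ≡ -1` modulo `4`.
    · exfalso
      have h3 := (hinv _ h1 h2).2
      rw [pow_succ, pow_mul] at h3
      obtain ⟨s, hs⟩ := hact (g ^ 2 ^ l)
      have h4 := zpow_mul_pow_eq hs 2 1
      rw [zpow_one, h3, mul_right_inj, ← zpow_neg_one, ← mul_inv_eq_one, ← zpow_neg, ← zpow_add,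
        hdvd] at h4
      have h5 : (4 : ℤ) ∣ -1 + -(s ^ 2 * 1) := (Dvd.intro_left (2 ^ k) (by ring)).trans h4
      rcases Int.even_or_odd' s with ⟨t, rfl | rfl⟩
      · ring_nf at h5; omega
      · ring_nf at h5; omega
  -- Two inversions compose to the identity on `a`, so the product centralizes `a`.
  have hcover : ∀ g h, g ∉ Subgroup.zpowers a → h ∉ Subgroup.zpowers a →
      g⁻¹ * h ∈ Subgroup.zpowers a := by
    intro g h hg hh
    have e1 := hinv' g⁻¹ (fun h => hg (by simpa using h))
    have e2 := hinv' h hh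
    refine hself' _ ?_
    have e3 : a⁻¹ * h = h * a := by
      rw [inv_mul_eq_iff_eq_mul, ← mul_assoc, e2, inv_mul_cancel_right]
    rw [← mul_assoc, e1, mul_assoc, e3, mul_assoc]
  have hy2 : y * y ∈ Subgroup.zpowers a := by
    have := hcover y⁻¹ y (fun h => hy (by simpa using h)) hy
    rwa [inv_inv] at this
  -- `y` both commutes with `y * y` and, as it inverts `a`, inverts it.
  have hy4 : (y * y) ^ 2 = 1 := by
    obtain ⟨j, hj⟩ := Subgroup.mem_zpowers_iff.mp hy2
    have h := zpow_mul_eq_mul_zpow (s := -1) (by rw [hinv' y hy, zpow_neg_one]) j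
    rw [hj, mul_assoc, mul_right_inj, neg_one_mul, zpow_neg, hj] at h
    rw [pow_two]
    nth_rw 1 [h]
    exact inv_mul_cancel _
  have h2k : orderOf (a ^ 2 ^ (k + 1)) = 2 := by
    rw [orderOf_pow_of_dvd (by positivity) (hm ▸ pow_dvd_pow 2 (by omega)), hm, pow_succ,
      Nat.mul_div_cancel_left _ (by positivity)]
  have hyne : y * y ≠ 1 := by
    intro h
    have hyo := orderOf_eq_prime (by rwa [pow_two]) fun h : y = 1 => hy (h ▸ Subgroup.one_mem _)
    exact hy (Subgroup.zpowers_le.mpr (Subgroup.pow_mem _ (Subgroup.mem_zpowers a) _)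
      (hU _ _ h2k hyo))
  refine ⟨k + 1, by omega, QuaternionGroup.nonempty_mulEquiv (by rw [hm]; ring) hy (hinv' y hy) ?_
    fun g hg => hcover y g hy hg⟩
  obtain ⟨i, hi⟩ := Subgroup.mem_zpowers_iff.mp (hU _ _ h2k (orderOf_eq_prime hy4 hyne))
  have hsq : (a ^ 2 ^ (k + 1)) ^ (2 : ℤ) = 1 := by
    exact_mod_cast orderOf_dvd_iff_pow_eq_one.mp h2k.dvd
  rcases Int.even_or_odd' i with ⟨t, rfl | rfl⟩
  · rw [zpow_mul, hsq, one_zpow] at hi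
    exact absurd hi.symm hyne
  · rw [zpow_add, zpow_mul, hsq, one_zpow, one_mul, zpow_one] at hi
    exact hi.symm

/-! ### Power graphs of `p`-groups -/

theorem powerGraph_adj_iff {G : Type*} [Group G] [Finite G] {u v : G} :
    (powerGraph G).Adj u v ↔
      u ≠ v ∧ (v ∈ Subgroup.zpowers u ∨ u ∈ Subgroup.zpowers v) := by
  have key : ∀ x y : G, (∃ k : ℕ, 0 < k ∧ y = x ^ k) ↔ y ∈ Subgroup.zpowers x := by
    intro x y
    constructor
    · rintro ⟨k, -, rfl⟩
      exact Subgroup.pow_mem _ (Subgroup.mem_zpowers x) k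
    · intro h
      obtain ⟨k, rfl⟩ := mem_powers_iff_mem_zpowers.mpr h
      -- Adding the order makes the exponent positive even when `k = 0`.
      exact ⟨k + orderOf x, by have := orderOf_pos x; omega, by simp [pow_add, pow_orderOf_eq_one]⟩
  exact and_congr_right fun _ => or_congr (key u v) (key v u)

/-- With `y = g ^ j` and `d = gcd (orderOf g) j`, Bézout makes `g ^ d` a power of `y`, and the order
condition forces `d` to divide the exponent of `x`. -/
theorem mem_zpowers_of_orderOf_dvd {G : Type*} [Group G] [Finite G] {g x y : G}
    (hx : x ∈ Subgroup.zpowers g) (hy : y ∈ Subgroup.zpowers g) (h : orderOf x ∣ orderOf y) :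
    x ∈ Subgroup.zpowers y := by
  obtain ⟨i, rfl⟩ := mem_powers_iff_mem_zpowers.mpr hx
  obtain ⟨j, rfl⟩ := mem_powers_iff_mem_zpowers.mpr hy
  simp only at h ⊢
  have h1 := orderOf_dvd_iff_pow_eq_one.mp h
  rw [← pow_mul, ← orderOf_dvd_iff_pow_eq_one, orderOf_pow] at h1
  have hd : (orderOf g).gcd j ∣ orderOf g := Nat.gcd_dvd_left _ _
  obtain ⟨n, hn⟩ := hd
  have hpos := orderOf_pos g
  have hdpos : 0 < (orderOf g).gcd j := Nat.gcd_pos_of_pos_left _ hpos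
  have hn0 : 0 < n := Nat.pos_of_ne_zero fun h => by rw [h, mul_zero] at hn; omega
  have hdiv : orderOf g / (orderOf g).gcd j = n := by
    conv_lhs => enter [1]; rw [hn]
    exact Nat.mul_div_cancel_left _ hdpos
  rw [hdiv] at h1
  have h2 : (orderOf g).gcd j * n ∣ i * n := hn ▸ h1
  obtain ⟨e, he⟩ := Nat.dvd_of_mul_dvd_mul_right hn0 h2
  have hbez := Nat.gcd_eq_gcd_ab (orderOf g) j
  have hgd : g ^ (orderOf g).gcd j = (g ^ j) ^ ((orderOf g).gcdB j) := by
    rw [← zpow_natCast, hbez, zpow_add, zpow_mul, zpow_natCast, pow_orderOf_eq_one, one_zpow,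
      one_mul, zpow_mul, zpow_natCast]
  rw [he, pow_mul, hgd]
  exact Subgroup.pow_mem _ (Subgroup.zpow_mem_zpowers _ _) e

/-- Orders are powers of `p`, hence comparable under divisibility, so the graph is complete and
every vertex may be put into `D`. -/
theorem vertexConnectivity_powerGraph_lt_of_isCyclic {p : ℕ} [Fact p.Prime] {G : Type*} [Group G]
    [Fintype G] [Nontrivial G] (hG : IsPGroup p G) (hc : IsCyclic G) :
    (vertexConnectivity (powerGraph G) : ℝ) < algebraicConnectivity (powerGraph G) := by
  obtain ⟨g, hg⟩ := hc.exists_generator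
  have hadj : ∀ d ∈ (Finset.univ : Finset G), ∀ v, d ≠ v → (powerGraph G).Adj d v := by
    intro d _ v hdv
    refine powerGraph_adj_iff.mpr ⟨hdv, ?_⟩
    obtain ⟨k, hk⟩ := IsPGroup.iff_orderOf.mp hG d
    obtain ⟨l, hl⟩ := IsPGroup.iff_orderOf.mp hG v
    rcases le_total k l with h | h
    · exact Or.inr (mem_zpowers_of_orderOf_dvd (hg d) (hg v) (hk ▸ hl ▸ pow_dvd_pow p h))
    · exact Or.inl (mem_zpowers_of_orderOf_dvd (hg v) (hg d) (hk ▸ hl ▸ pow_dvd_pow p h))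
  refine lt_of_lt_of_le ?_ (card_le_algebraicConnectivity hadj)
  exact_mod_cast vertexConnectivity_lt_card (powerGraph G)

/-- In a finite `p`-group with two subgroups of order `p`, the identity separates the power
graph. -/
theorem connectivity_powerGraph_eq_one {p : ℕ} [Fact p.Prime] {G : Type*} [Group G]
    [Fintype G] [Nontrivial G] (hG : IsPGroup p G) {x y : G} (hx : orderOf x = p)
    (hy : orderOf y = p) (hxy : y ∉ Subgroup.zpowers x) :
    vertexConnectivity (powerGraph G) = 1 ∧ algebraicConnectivity (powerGraph G) = 1 := by
  classical
  have hp : p.Prime := Fact.out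
  have hx1 : x ≠ 1 := by rintro rfl; exact hp.one_lt.ne (by simpa using hx)
  have hy1 : y ≠ 1 := by rintro rfl; exact hp.one_lt.ne (by simpa using hy)
  have hmem1 : ∀ g : G, x ∈ Subgroup.zpowers g → g ≠ 1 := by
    rintro _ h rfl
    exact hx1 (by simpa using h)
  let C : Finset G := Finset.univ.filter fun g => x ∈ Subgroup.zpowers g
  have hD : ∀ d ∈ ({1} : Finset G), ∀ v, d ≠ v → (powerGraph G).Adj d v := by
    intro d hd v hdv
    rw [Finset.mem_singleton] at hd
    subst hd
    exact powerGraph_adj_iff.mpr ⟨hdv, Or.inr (Subgroup.one_mem _)⟩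
  have hCD : Disjoint C {1} := by
    rw [Finset.disjoint_singleton_right]
    exact fun h => hmem1 1 (Finset.mem_filter.mp h).2 rfl
  have hxC : x ∈ C := by simp [C]
  have hyC : y ∉ C := fun h => hxy
    (mem_zpowers_of_orderOf_dvd (Subgroup.mem_zpowers y) (Finset.mem_filter.mp h).2
      (by rw [hx, hy]))
  have hC : ∀ g ∈ C, ∀ h, h ∉ C → h ∉ ({1} : Finset G) → ¬ (powerGraph G).Adj g h := by
    intro g hg h hhC hh1 hadj
    have hxg : x ∈ Subgroup.zpowers g := (Finset.mem_filter.mp hg).2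
    refine hhC (Finset.mem_filter.mpr ⟨Finset.mem_univ h, ?_⟩)
    rcases (powerGraph_adj_iff.mp hadj).2 with hhg | hgh
    -- The power of `h` of order `p` lies in the cyclic group of `g`, so it generates the same
    -- subgroup as `x`.
    · obtain ⟨k, -, hk⟩ := hG.exists_orderOf_pow_eq_prime (by simpa using hh1 : h ≠ 1)
      have hle : Subgroup.zpowers (h ^ k) ≤ Subgroup.zpowers h :=
        Subgroup.zpowers_le.mpr (Subgroup.pow_mem _ (Subgroup.mem_zpowers h) k)
      exact hle (mem_zpowers_of_orderOf_dvd hxg (Subgroup.pow_mem _ hhg k) (by rw [hx, hk]))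
    · exact Subgroup.zpowers_le.mpr hgh hxg
  have hy1' : y ∉ ({1} : Finset G) := by simpa using hy1
  refine ⟨?_, ?_⟩
  · rw [vertexConnectivity_eq_card hD hCD hxC hyC hy1' hC, Finset.card_singleton]
  · rw [algebraicConnectivity_eq_card hD hCD hxC hyC hy1' hC, Finset.card_singleton, Nat.cast_one]

/-! ### Generalized quaternion groups -/

-- Each `xa j` has order `4`; `a j` squares to `1` only when `n` divides `j`, and even multiples of
-- `n` give the identity.
open QuaternionGroup in
theorem QuaternionGroup.eq_a_of_orderOf_eq_two {n : ℕ} [NeZero n] {q : QuaternionGroup n}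
    (hq : orderOf q = 2) : q = a n := by
  rcases q with j | j
  · have h := pow_orderOf_eq_one (a j)
    have hne : a j ≠ 1 := fun h => by rw [h, orderOf_one] at hq; omega
    rw [hq, pow_two, a_mul_a, one_def, a.injEq] at h
    obtain ⟨i, rfl⟩ := ZMod.intCast_surjective j
    rw [← Int.cast_add, ZMod.intCast_zmod_eq_zero_iff_dvd] at h
    obtain ⟨t, ht⟩ := h
    push_cast at ht
    obtain rfl : i = n * t := by linarith
    rcases Int.even_or_odd' t with ⟨s, rfl | rfl⟩
    · refine absurd ?_ hne
      rw [one_def, a.injEq, ZMod.intCast_zmod_eq_zero_iff_dvd]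
      exact ⟨s, by push_cast; ring⟩
    · rw [a.injEq, ← Int.cast_natCast (R := ZMod (2 * n)) n, ← sub_eq_zero, ← Int.cast_sub,
        ZMod.intCast_zmod_eq_zero_iff_dvd]
      exact ⟨s, by push_cast; ring⟩
  · rw [orderOf_xa] at hq
    omega

open QuaternionGroup in
theorem QuaternionGroup.a_mem_zpowers {n : ℕ} (i : ZMod (2 * n)) :
    (a i : QuaternionGroup n) ∈ Subgroup.zpowers (a 1) := by
  obtain ⟨k, rfl⟩ := ZMod.intCast_surjective i
  obtain ⟨m, rfl | rfl⟩ := k.eq_nat_or_neg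
  · rw [Int.cast_natCast, ← a_one_pow]
    exact Subgroup.pow_mem _ (Subgroup.mem_zpowers _) m
  · have : (a ((-(m : ℤ) : ℤ) : ZMod (2 * n)) : QuaternionGroup n) = (a 1 ^ m)⁻¹ := by
      rw [eq_inv_iff_mul_eq_one, a_one_pow, a_mul_a, one_def]
      simp
    rw [this]
    exact Subgroup.inv_mem _ (Subgroup.pow_mem _ (Subgroup.mem_zpowers _) m)

open QuaternionGroup in
theorem QuaternionGroup.xa_notMem_zpowers {n : ℕ} [NeZero n] (i : ZMod (2 * n)) :
    (xa i : QuaternionGroup n) ∉ Subgroup.zpowers (a 1) := by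
  intro h
  obtain ⟨k, hk⟩ := mem_powers_iff_mem_zpowers.mpr h
  simp only [a_one_pow] at hk
  cases hk

open QuaternionGroup in
/-- The center of a generalized quaternion group separates its power graph. -/
theorem IsGeneralizedQuaternion.connectivity_powerGraph {G : Type*} [Group G] [Fintype G]
    [Nontrivial G] (hQ : IsGeneralizedQuaternion G) :
    vertexConnectivity (powerGraph G) = 2 ∧ algebraicConnectivity (powerGraph G) = 2 := by
  classical
  obtain ⟨k, hk, ⟨e⟩⟩ := hQ
  have hG : IsPGroup 2 G := by
    refine IsPGroup.of_card (n := k + 2) ?_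
    rw [Nat.card_congr e.toEquiv, Nat.card_eq_fintype_card, QuaternionGroup.card]
    ring
  set n := 2 ^ k with hn
  have hn2 : 2 ≤ n := by simpa using Nat.pow_le_pow_right two_pos hk
  set z : G := e.symm (a n) with hz
  have hez : e z = a n := e.apply_symm_apply _
  have hz_mem : ∀ g : G, g ≠ 1 → z ∈ Subgroup.zpowers g := by
    intro g hg
    obtain ⟨l, -, hl⟩ := hG.exists_orderOf_pow_eq_prime hg
    have h := eq_a_of_orderOf_eq_two (q := e (g ^ l)) (by rw [MulEquiv.orderOf_eq, hl])
    have h' : z = g ^ l := by rw [hz, ← h, e.symm_apply_apply]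
    rw [h']
    exact Subgroup.pow_mem _ (Subgroup.mem_zpowers g) l
  have hsq : ∀ j : ZMod (2 * n), (xa j : QuaternionGroup n) ^ 2 = a n := xa_sq
  have hz1 : (1 : G) ≠ z := by
    intro h
    have h4 := orderOf_xa (n := n) 0
    have h2 : (xa 0 : QuaternionGroup n) ^ 2 = 1 := by rw [hsq, ← hez, ← h, map_one]
    have := orderOf_dvd_of_pow_eq_one h2
    rw [h4] at this
    omega
  have hz2 : z ^ 2 = 1 := e.injective (by
    rw [map_pow, hez, ← hsq 0, ← pow_mul, map_one, xa_pow_four])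
  let C : Finset G :=
    (Finset.univ.filter fun g => e g ∈ Subgroup.zpowers (a 1 : QuaternionGroup n)) \ {1, z}
  have hD : ∀ d ∈ ({1, z} : Finset G), ∀ v, d ≠ v → (powerGraph G).Adj d v := by
    intro d hd v hdv
    refine powerGraph_adj_iff.mpr ⟨hdv, ?_⟩
    by_cases hv : v = 1
    · exact Or.inl (hv ▸ Subgroup.one_mem _)
    · right
      rcases Finset.mem_insert.mp hd with rfl | h
      · exact Subgroup.one_mem _
      · exact Finset.mem_singleton.mp h ▸ hz_mem v hv
  have hCD : Disjoint C {1, z} := Finset.sdiff_disjoint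
  have hu : e.symm (a 1) ∈ C := by
    have h2 : (e.symm (a 1) : G) ^ 2 ≠ 1 := by
      intro h
      rw [← map_pow, map_eq_one_iff _ e.symm.injective] at h
      have := Nat.le_of_dvd two_pos (orderOf_dvd_of_pow_eq_one h)
      rw [orderOf_a_one] at this
      omega
    simp only [C, Finset.mem_sdiff, Finset.mem_filter, Finset.mem_univ, true_and,
      e.apply_symm_apply, Subgroup.mem_zpowers, Finset.mem_insert, Finset.mem_singleton]
    rintro (h | h)
    · exact h2 (by rw [h, one_pow])
    · exact h2 (by rw [h, hz2])
  have hv : e (e.symm (xa 0)) ∉ Subgroup.zpowers (a 1 : QuaternionGroup n) := by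
    rw [e.apply_symm_apply]
    exact xa_notMem_zpowers 0
  have hDmem : ∀ g ∈ ({1, z} : Finset G), e g ∈ Subgroup.zpowers (a 1 : QuaternionGroup n) := by
    intro g hg
    rcases Finset.mem_insert.mp hg with rfl | h
    · rw [map_one]; exact Subgroup.one_mem _
    · rw [Finset.mem_singleton.mp h, hez]
      exact a_mem_zpowers _
  have hvC : e.symm (xa 0) ∉ C := fun h =>
    hv (Finset.mem_filter.mp (Finset.mem_sdiff.mp h).1).2
  have hvD : e.symm (xa 0) ∉ ({1, z} : Finset G) := fun h => hv (hDmem _ h)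
  have hC : ∀ g ∈ C, ∀ h, h ∉ C → h ∉ ({1, z} : Finset G) → ¬ (powerGraph G).Adj g h := by
    intro g hg h hhC hhD hadj
    obtain ⟨hg1, hgD⟩ := Finset.mem_sdiff.mp hg
    replace hg1 := (Finset.mem_filter.mp hg1).2
    have hh : e h ∉ Subgroup.zpowers (a 1 : QuaternionGroup n) := fun hh =>
      hhC (Finset.mem_sdiff.mpr ⟨Finset.mem_filter.mpr ⟨Finset.mem_univ _, hh⟩, hhD⟩)
    rcases (powerGraph_adj_iff.mp hadj).2 with h1 | h1
    · obtain ⟨t, rfl⟩ := Subgroup.mem_zpowers_iff.mp h1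
      exact hh (map_zpow e g t ▸ Subgroup.zpow_mem _ hg1 t)
    · obtain ⟨t, rfl⟩ := mem_powers_iff_mem_zpowers.mpr h1
      simp only at hg1 hgD
      have hh2 : h ^ 2 = z := by
        rcases hq : e h with j | j
        · exact absurd (hq ▸ a_mem_zpowers j) hh
        · exact e.injective (by rw [map_pow, hq, hsq, hez])
      -- As `h ^ 2 = z`, even powers of `h` lie in `{1, z}` and odd ones outside the cyclic
      -- subgroup.
      rcases Nat.even_or_odd' t with ⟨s, rfl | rfl⟩
      · apply hgD
        rw [pow_mul, hh2]
        rcases Nat.even_or_odd' s with ⟨r, rfl | rfl⟩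
        · simp [pow_mul, hz2]
        · simp [pow_succ, pow_mul, hz2]
      · refine hh ?_
        rw [pow_succ, pow_mul, hh2, map_mul, map_pow] at hg1
        exact (Subgroup.mul_mem_cancel_left _
          (Subgroup.pow_mem _ (hDmem z (by simp)) s)).mp hg1
  have hcard : ({1, z} : Finset G).card = 2 := Finset.card_pair hz1
  refine ⟨?_, ?_⟩
  · rw [vertexConnectivity_eq_card hD hCD hu hvC hvD hC, hcard]
  · rw [algebraicConnectivity_eq_card hD hCD hu hvC hvD hC, hcard, Nat.cast_two]

theorem mainTheorem8 {p : ℕ} (hp : p.Prime) (G : Type*) [Group G] [Fintype G] [Nontrivial G]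
    (hG : IsPGroup p G) :
    ((vertexConnectivity (powerGraph G) : ℝ) = algebraicConnectivity (powerGraph G) ↔
      ¬ IsCyclic G) ∧
    (IsGeneralizedQuaternion G →
      vertexConnectivity (powerGraph G) = 2 ∧ algebraicConnectivity (powerGraph G) = 2) ∧
    (¬ IsCyclic G → ¬ IsGeneralizedQuaternion G →
      vertexConnectivity (powerGraph G) = 1 ∧ algebraicConnectivity (powerGraph G) = 1) := by
  have := Fact.mk hp
  have hone : ¬ IsCyclic G → ¬ IsGeneralizedQuaternion G →
      vertexConnectivity (powerGraph G) = 1 ∧ algebraicConnectivity (powerGraph G) = 1 := by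
    intro hc hq
    by_contra hcon
    refine (hG.isCyclic_or_isGeneralizedQuaternion fun x y hx hy => ?_).elim hc hq
    by_contra hxy
    exact hcon (connectivity_powerGraph_eq_one hG hx hy hxy)
  refine ⟨⟨fun h hc => (vertexConnectivity_powerGraph_lt_of_isCyclic hG hc).ne h, fun hc => ?_⟩,
    IsGeneralizedQuaternion.connectivity_powerGraph, hone⟩
  by_cases hq : IsGeneralizedQuaternion G
  · rw [hq.connectivity_powerGraph.1, hq.connectivity_powerGraph.2, Nat.cast_two]
  · rw [(hone hc hq).1, (hone hc hq).2, Nat.cast_one]
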